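/- **Setting.** Let $E$ and $\Omega$ be finite sets (edges of a parallel network, states), let $\ell_e^\omega(t)=a_e^\omega t+b_e^\omega$ with $a_e^\omega>0$, $b_e^\omega\ge 0$, let $X$ be a finite subset of the simplex $\Delta(E)$, let $\mu_0\in\Delta(\Omega)$, and let $\|\cdot\|$ be any norm on $\mathbb R^{\Omega}$ with dual norm $\|\cdot\|_*$. A policy is $\pi=(\pi_\omega(x))_{\omega\in\Omega,x\in X}\in\mathbb R^{\Omega\times X}$ with $\pi_\omega\in\Delta(X)$ for all $\omega$. Put $\mathcal J=\{(r,a)\in E\times E: r\ne a\}$ and $$C(\pi)=\sum_\omega\mu_0(\omega)\sum_{x\in X}\pi_\omega(x)\sum_{e}x_e\ell^\omega_e(x_e),\qquad D_{r,a}(\pi)=\Bigl(\sum_{x\in X}\pi_\omega(x)\,x_r\bigl(\ell_a^\omega(x_a)-\ell_r^\omega(x_r)\bigr)\Bigr)_{\omega\in\Omega},$$ $$A_{r,a}(\pi;\mu)=\langle\mu,D_{r,a}(\pi)\rangle,\qquad h_{r,a}(\pi,\varepsilon)=A_{r,a}(\pi;\mu_0)-\varepsilon\|D_{r,a}(\pi)\|_*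 .$$ For $\varepsilon\ge 0$ let $\mathrm{OC}_\varepsilon$ be the set of policies with $h_{r,a}(\pi,\varepsilon)\ge 0$ for all $(r,a)\in\mathcal J$, and let $\overline{\mathrm{OC}}_\varepsilon\supseteq\mathrm{OC}_\varepsilon$ be the set of policies with $A_{r,a}(\pi;\mu)\ge0$ for all $(r,a)\in\mathcal J$ and all $\mu\in\Delta(\Omega)$ with $\|\mu-\mu_0\|\le\varepsilon$. For $R_\varepsilon$ equal to $\mathrm{OC}_\varepsilon$ or to $\overline{\mathrm{OC}}_\varepsilon$, the robust value function is $V^*(\varepsilon)=\min_{\pi\in R_\varepsilon}C(\pi)$, defined on the set of radii $\varepsilon\ge 0$ with $R_\varepsilon\neq\varnothing$; derivatives of $V^*$ are taken relative to this set (so at $\varepsilon=0$ they are one-sided). Let $T=\{v\in\mathbb R^{\Omega\times X}:\sum_{x}v_\omega(x)=0\ \forall\omega\}$ with orthogonal projection $P_T$. For a policy $\pi^*$ let $B(\varepsilon)=\{(r,a)\in\mathcal J:h_{r,a}(\pi^*,\varepsilon)=0\}$, let $G_B^T$ be the matrix with columns $P_T\nabla_\pi h_{r,a}(\pi^*,\varepsilon)$,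 $(r,a)\in B(\varepsilon)$, and let $\sigma_{\min}(G_B^T)$ be the smallest of its $|B(\varepsilon)|$ singular values. Let $$\Delta_{\max}=\max_{(r,a)\in\mathcal J,\,\omega,\,x\in X}\bigl|x_r(\ell_a^\omega(x_a)-\ell_r^\omega(x_r))\bigr|,\qquad \kappa_\Omega=\sup_{z\ne0}\|z\|_*/\|z\|_\infty ,\qquad \mathcal L(\pi,\lambda)=C(\pi)-\sum_{(r,a)\in\mathcal J}\lambda_{r,a}h_{r,a}(\pi,\varepsilon).$$ **Theorem.** Let $\varepsilon\ge 0$ be a point at which $V^*$ is differentiable, and let $\pi^*$ be a minimizer of $C$ over $R_\varepsilon$ that is an isolated local minimizer. Assume: 1. $C$ is $C^2$ near $\pi^*$ and each $h_{r,a}$ with $(r,a)\in B(\varepsilon)$ is $C^2$ in a neighborhood of $(\pi^*,\varepsilon)$; 2. there is $\lambda^*\in\mathbb R^{\mathcal J}$ such that $(\pi^*,\lambda^*)$ is a KKT pair: $\pi^*\in\mathrm{OC}_\varepsilon$, $\lambda^*_{r,a}\ge 0$, $\lambda^*_{r,a}h_{r,a}(\pi^*,\varepsilon)=0$ for all $(r,a)$,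 and $P_T\nabla_\pi\mathcal L(\pi^*,\lambda^*)=0$; 3. (LICQ) $\sigma_{\min}(G_B^T)>0$ (no condition if $B(\varepsilon)=\varnothing$); 4. (second-order sufficiency) $\nabla^2_{\pi\pi}\mathcal L(\pi^*,\lambda^*)[v,v]>0$ for every nonzero $v\in T$ that is orthogonal to all $P_T\nabla_\pi h_{r,a}(\pi^*,\varepsilon)$, $(r,a)\in B(\varepsilon)$; 5. the constraints $\pi_\omega(x)\ge0$ are inactive at $\pi^*$, that is, $\pi^*_\omega(x)>0$ for all $\omega$ and $x$; for $R_\varepsilon=\mathrm{OC}_\varepsilon$ this is needed only if $\varepsilon=0$. Then $$\frac{d}{d\varepsilon}V^*(\varepsilon)\le\kappa_\Omega\,\Delta_{\max}\sqrt{|B(\varepsilon)|}\;\frac{\|P_T\nabla C(\pi^*)\|_2}{\sigma_{\min}(G_B^T)},$$ where the right-hand side is read as $0$ if $B(\varepsilon)=\varnothing$. -/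

import Mathlib

open Set Topology

noncomputable section

/-- Ordered deviation pairs `(r, a)` with `r ≠ a`: recommended edge `r`, chosen edge `a`. -/
abbrev DevPair (E : Type*) : Type _ := {p : E × E // p.1 ≠ p.2}

/-- The data of a Bayesian congestion game on a parallel network with edges `E`, states `Ω`,
affine latencies `ℓ_e^ω(t) = slope ω e * t + freeFlow ω e`, a finite set `X` of recommendation
profiles in the simplex over `E`, a nominal prior, and an arbitrary norm `nrm` on `ℝ^Ω`. -/
structure SignalingGame (E Ω : Type*) [Fintype E] [Fintype Ω] where
  slope : Ω → E → ℝ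
  slope_pos : ∀ ω e, 0 < slope ω e
  freeFlow : Ω → E → ℝ
  freeFlow_nonneg : ∀ ω e, 0 ≤ freeFlow ω e
  X : Finset (E → ℝ)
  X_subset : ∀ x ∈ X, x ∈ stdSimplex ℝ E
  prior : Ω → ℝ
  prior_mem : prior ∈ stdSimplex ℝ Ω
  nrm : Seminorm ℝ (Ω → ℝ)
  nrm_definite : ∀ z, nrm z = 0 → z = 0

namespace SignalingGame

variable {E Ω : Type*} [Fintype E] [Fintype Ω]

/-- The Euclidean space `ℝ^(Ω × X)` in which policies live; `π (ω, x)` is `π_ω(x)`. -/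
abbrev PolicySpace (G : SignalingGame E Ω) : Type _ := EuclideanSpace ℝ (Ω × G.X)

/-- The latency `ℓ_e^ω(t)`. -/
def latency (G : SignalingGame E Ω) (ω : Ω) (e : E) (t : ℝ) : ℝ :=
  G.slope ω e * t + G.freeFlow ω e

/-- Signaling policies: `π_ω` is a probability vector on `X` for every state `ω`. -/
def policies (G : SignalingGame E Ω) : Set G.PolicySpace :=
  {π | (∀ ω x, 0 ≤ π (ω, x)) ∧ ∀ ω, ∑ x, π (ω, x) = 1}

/-- The planner's expected social cost `C(π)` under the nominal prior. -/
def cost (G : SignalingGame E Ω) (π : G.PolicySpace) : ℝ :=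
  ∑ ω, G.prior ω * ∑ x : G.X, π (ω, x) * ∑ e, x.1 e * G.latency ω e (x.1 e)

/-- The realized gap `x_r (ℓ_a^ω(x_a) - ℓ_r^ω(x_r))` for the pair `i = (r, a)`. -/
def gap (G : SignalingGame E Ω) (i : DevPair E) (ω : Ω) (x : G.X) : ℝ :=
  x.1 i.1.1 * (G.latency ω i.1.2 (x.1 i.1.2) - G.latency ω i.1.1 (x.1 i.1.1))

/-- The vector `D_{r,a}(π) ∈ ℝ^Ω`. -/
def devVec (G : SignalingGame E Ω) (i : DevPair E) (π : G.PolicySpace) : Ω → ℝ :=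
  fun ω => ∑ x, π (ω, x) * G.gap i ω x

/-- The obedience slack `A_{r,a}(π; μ)`. -/
def slack (G : SignalingGame E Ω) (i : DevPair E) (π : G.PolicySpace) (μ : Ω → ℝ) : ℝ :=
  ∑ ω, μ ω * ∑ x, π (ω, x) * G.gap i ω x

/-- The uncertainty set `U_ε(μ₀)`. -/
def beliefs (G : SignalingGame E Ω) (ε : ℝ) : Set (Ω → ℝ) :=
  {μ | μ ∈ stdSimplex ℝ Ω ∧ G.nrm (μ - G.prior) ≤ ε}

/-- The robust obedience region: policies obedient under every belief in `U_ε(μ₀)`. -/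
def robustRegion (G : SignalingGame E Ω) (ε : ℝ) : Set G.PolicySpace :=
  {π | π ∈ G.policies ∧ ∀ μ ∈ G.beliefs ε, ∀ i, 0 ≤ G.slack i π μ}

/-- The norm dual to `nrm`. -/
def dualNorm (G : SignalingGame E Ω) (z : Ω → ℝ) : ℝ :=
  sSup {t | ∃ y : Ω → ℝ, G.nrm y ≤ 1 ∧ t = ∑ ω, y ω * z ω}

/-- The robust constraint function `h_{r,a}(π, ε) = A_{r,a}(π; μ₀) - ε ‖D_{r,a}(π)‖_*`. -/
def robustSlack (G : SignalingGame E Ω) (i : DevPair E) (π : G.PolicySpace) (ε : ℝ) : ℝ :=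
  G.slack i π G.prior - ε * G.dualNorm (G.devVec i π)

/-- The region `{π : h_{r,a}(π, ε) ≥ 0 for all (r, a)}` cut out by the robust constraint
functions. It is contained in `robustRegion`, and can be smaller because beliefs are
probability vectors. -/
def dualRegion (G : SignalingGame E Ω) (ε : ℝ) : Set G.PolicySpace :=
  {π | π ∈ G.policies ∧ ∀ i, 0 ≤ G.robustSlack i π ε}

/-- Radii `ε ≥ 0` at which the feasible region `R ε` is nonempty. -/
def feasibleRadii {G : SignalingGame E Ω} (R : ℝ → Set G.PolicySpace) : Set ℝ :=
  {ε | 0 ≤ ε ∧ (R ε).Nonempty}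

/-- The value function `ε ↦ min_{π ∈ R ε} C(π)`, used only on `feasibleRadii R`. -/
def value (G : SignalingGame E Ω) (R : ℝ → Set G.PolicySpace) (ε : ℝ) : ℝ :=
  sInf (G.cost '' R ε)

/-- `π` is an optimal solution over `S`. -/
def IsOptimal (G : SignalingGame E Ω) (S : Set G.PolicySpace) (π : G.PolicySpace) : Prop :=
  π ∈ S ∧ IsMinOn G.cost S π

/-- `π` is an isolated local minimizer of the cost over `S`: it is a local minimizer, and some
neighborhood of it contains no other local minimizer. -/
def IsIsolatedLocalMin (G : SignalingGame E Ω) (S : Set G.PolicySpace)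
    (π : G.PolicySpace) : Prop :=
  π ∈ S ∧ IsLocalMinOn G.cost S π ∧
    ∀ᶠ π' in 𝓝 π, π' ∈ S → IsLocalMinOn G.cost S π' → π' = π

/-- The tangent space `T` of the simplex constraints: `∑_x v_ω(x) = 0` for every `ω`. -/
def tangent (G : SignalingGame E Ω) : Submodule ℝ G.PolicySpace where
  carrier := {v | ∀ ω, ∑ x, v (ω, x) = 0}
  zero_mem' := by simp
  add_mem' := by
    intro v w hv hw ω
    have h : ∑ x, (v + w) (ω, x) = ∑ x, v (ω, x) + ∑ x, w (ω, x) := by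
      rw [← Finset.sum_add_distrib]; rfl
    rw [h, hv ω, hw ω, add_zero]
  smul_mem' := by
    intro c v hv ω
    have h : ∑ x, (c • v) (ω, x) = c * ∑ x, v (ω, x) := by
      rw [Finset.mul_sum]; rfl
    rw [h, hv ω, mul_zero]

/-- The projected gradient `P_T ∇_π h_{r,a}(π, ε)`. -/
def projGrad (G : SignalingGame E Ω) (i : DevPair E) (π : G.PolicySpace) (ε : ℝ) :
    G.PolicySpace :=
  G.tangent.starProjection (gradient (fun π' => G.robustSlack i π' ε) π)

/-- The projected cost gradient `P_T ∇C(π)`. -/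
def projCostGrad (G : SignalingGame E Ω) (π : G.PolicySpace) : G.PolicySpace :=
  G.tangent.starProjection (gradient G.cost π)

/-- `Δ_max`, the largest realized gap in absolute value (`0` if there is no pair). -/
def deltaMax (G : SignalingGame E Ω) : ℝ :=
  ⨆ q : DevPair E × Ω × G.X, |G.gap q.1 q.2.1 q.2.2|

/-- `κ_Ω = sup_{z ≠ 0} ‖z‖_* / ‖z‖_∞`; here `‖z‖` is the sup norm on `Ω → ℝ`. -/
def kappa (G : SignalingGame E Ω) : ℝ :=
  ⨆ z : {z : Ω → ℝ // z ≠ 0}, G.dualNorm z.1 / ‖z.1‖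

variable [DecidableEq E]

/-- The active set `B(ε)` at `π`. -/
def active (G : SignalingGame E Ω) (π : G.PolicySpace) (ε : ℝ) : Finset (DevPair E) :=
  {i | G.robustSlack i π ε = 0}

/-- The projected active-constraint Jacobian `G_Bᵀ`, whose columns are the vectors
`P_T ∇_π h_{r,a}(π, ε)`, `(r, a) ∈ B(ε)`. -/
def jacobian (G : SignalingGame E Ω) (π : G.PolicySpace) (ε : ℝ) :
    Matrix (Ω × G.X) (G.active π ε) ℝ :=
  Matrix.of fun p i => G.projGrad i.1 π ε p

/-- The smallest of the `|B(ε)|` singular values of `G_Bᵀ` (Mathlib lists singular values in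
decreasing order, starting at index `0`). It is positive iff the columns are independent, when
there are any. -/
def sigmaMin (G : SignalingGame E Ω) (π : G.PolicySpace) (ε : ℝ) : ℝ :=
  (Matrix.toEuclideanLin (G.jacobian π ε)).singularValues ((G.active π ε).card - 1)

/-- The Lagrangian `L(π, lam; ε) = C(π) - ∑ lam_{r,a} h_{r,a}(π, ε)`. -/
def lagrangian (G : SignalingGame E Ω) (lam : DevPair E → ℝ) (ε : ℝ) (π : G.PolicySpace) : ℝ :=
  G.cost π - ∑ i, lam i * G.robustSlack i π ε

/-- `(π, lam)` is a Karush–Kuhn–Tucker primal–dual pair of the problem with constraints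
`h_{r,a}(·, ε) ≥ 0`; stationarity is taken along the tangent space `T`. -/
structure IsKKTPair (G : SignalingGame E Ω) (ε : ℝ) (π : G.PolicySpace)
    (lam : DevPair E → ℝ) : Prop where
  feasible : π ∈ G.dualRegion ε
  nonneg : ∀ i, 0 ≤ lam i
  compl : ∀ i, lam i * G.robustSlack i π ε = 0
  stationary : G.tangent.starProjection (gradient (G.lagrangian lam ε) π) = 0

/-- The cost and the active robust constraint functions are `C²` near `(π, ε)`. -/
def IsSmoothAt (G : SignalingGame E Ω) (ε : ℝ) (π : G.PolicySpace) : Prop :=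
  ContDiffAt ℝ 2 G.cost π ∧
    ∀ i ∈ G.active π ε,
      ContDiffAt ℝ 2 (fun p : G.PolicySpace × ℝ => G.robustSlack i p.1 p.2) (π, ε)

/-- Second-order sufficiency: the Hessian of the Lagrangian in `π` is positive on the nonzero
vectors of `T` that are orthogonal to all active constraint gradients. -/
def SecondOrderSufficient (G : SignalingGame E Ω) (ε : ℝ) (π : G.PolicySpace)
    (lam : DevPair E → ℝ) : Prop :=
  ∀ v ∈ G.tangent, v ≠ 0 → (∀ i ∈ G.active π ε, inner ℝ (G.projGrad i π ε) v = 0) →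
    0 < fderiv ℝ (fderiv ℝ (G.lagrangian lam ε)) π v v

/-- The right-hand side of the slope bound. -/
def slopeBound (G : SignalingGame E Ω) (ε : ℝ) (π : G.PolicySpace) : ℝ :=
  G.kappa * G.deltaMax * √((G.active π ε).card : ℝ) * (‖G.projCostGrad π‖ / G.sigmaMin π ε)

end SignalingGame

end

/-!
The cost `C` and every slack `A_i(·; μ)` are linear in the policy, and `h_i(·, ε)` is the infimum of
the functions `A_i(·; μ)` over the ball of radius `ε` around the prior (`robustSlack_le_slack`,
`exists_slack_eq_robustSlack`). So the bound is a statement of convex duality, and difference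
quotients of the value function on one side are enough: feasible regions shrink as the radius
grows, hence `[0, ε]` lies in the set of feasible radii, and for `ε > 0` the derivative is a limit
of left difference quotients; for `ε = 0` it is a limit of right ones.

Stationarity says `C(v) = ∑ λ_i Dh_i(π, ε)[v]` for tangent vectors `v` (`IsKKTPair.cost_eq`), and
`∑ λ_i ≤ √|B| ‖P_T ∇C‖ / σ_min` (`IsKKTPair.sum_lam_le`). Since `‖D_i(π')‖_* ≤ κ Δ_max` for every
policy `π'` (`dualNorm_devVec_le`), it suffices to bound the difference quotients by
`κ Δ_max ∑ λ_i`.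

* For `ε > 0` (`IsKKTPair.cost_sub_le`), each pair `i` with `λ_i > 0` has a binding belief `μ_i` in
  the uncertainty set of its region, `A_i(π; μ_i) = h_i(π, ε) = 0`. The function `h_i(·, ε)` lies
  below `A_i(·; μ_i)` and touches it at `π`, so the two have the same derivative there, and
  `C(π') - C(π) = ∑ λ_i A_i(π'; μ_i)` for every policy `π'`. If `π'` is feasible at a radius
  `s < ε`, scaling `μ_i - μ₀` by `s / ε` gives
  `A_i(π'; μ_i) ≥ -(ε - s) ‖D_i(π')‖_*`. For the region of policies obedient under *probability
  vectors*, `h_i` may be active although no admissible belief is binding; in that case `λ_i = 0` by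
  optimality and the constraint qualification (`IsKKTPair.exists_binding_belief`).
* For `ε = 0` (`IsKKTPair.eventually_exists_mem_dualRegion`), the constraint qualification yields a
  tangent direction `v` that raises every active slack at the rate `κ Δ_max`. Then `π + t v` is
  feasible at radius `t` and costs `C(π) + t κ Δ_max ∑ λ_i`.
-/

/-! ### Singular values and relative derivatives -/

/-- The smallest singular value bounds a linear map from below. -/
theorem LinearMap.singularValues_mul_norm_le {V W : Type*} [NormedAddCommGroup V]
    [InnerProductSpace ℝ V] [FiniteDimensional ℝ V] [NormedAddCommGroup W]
    [InnerProductSpace ℝ W] [FiniteDimensional ℝ W] (A : V →ₗ[ℝ] W) {n : ℕ}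
    (hn : Module.finrank ℝ V = n) (x : V) :
    A.singularValues (n - 1) * ‖x‖ ≤ ‖A x‖ := by
  refine le_of_sq_le_sq ?_ (norm_nonneg _)
  set hS := A.isSymmetric_adjoint_comp_self
  set b := hS.eigenvectorBasis hn
  have h1 : ‖A x‖ ^ 2 = ∑ i, hS.eigenvalues hn i * (b.repr x i) ^ 2 := by
    rw [← real_inner_self_eq_norm_sq, ← LinearMap.adjoint_inner_left,
      ← LinearMap.comp_apply, ← b.repr.inner_map_map, PiLp.inner_apply]
    refine Finset.sum_congr rfl fun i _ => ?_
    rw [hS.eigenvectorBasis_apply_self_apply hn x i]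
    simp [b]
    ring
  rw [h1, mul_pow, ← b.repr.norm_map x, EuclideanSpace.norm_sq_eq, Finset.mul_sum]
  refine Finset.sum_le_sum fun i _ => ?_
  rw [Real.norm_eq_abs, sq_abs, ← A.sq_singularValues_fin hn i]
  gcongr
  · exact A.singularValues_nonneg _
  · exact A.singularValues_antitone (by omega)

/-- A bound on the slopes along a subset accumulating at `x` bounds the relative derivative. -/
theorem derivWithin_le_of_forall_slope_le {f : ℝ → ℝ} {S T : Set ℝ} {x m : ℝ}
    (hf : DifferentiableWithinAt ℝ f S x) (hTS : T ⊆ S \ {x}) [(𝓝[T] x).NeBot]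
    (h : ∀ s ∈ T, slope f x s ≤ m) : derivWithin f S x ≤ m :=
  le_of_tendsto ((hasDerivWithinAt_iff_tendsto_slope.1 hf.hasDerivWithinAt).mono_left
    (nhdsWithin_mono x hTS)) (Filter.eventually_of_mem self_mem_nhdsWithin h)

noncomputable section

namespace SignalingGame

variable {E Ω : Type*} [Fintype E] [Fintype Ω] (G : SignalingGame E Ω)

/-! ### The dual norm -/

theorem nrm_continuous : Continuous G.nrm := by
  have h : ConvexOn ℝ univ G.nrm := G.nrm.convexOn
  simpa [continuousOn_univ] using h.continuousOn isOpen_univ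

/-- The norm of the game dominates the sup norm, by its positive minimum on the unit sphere. -/
theorem exists_norm_le_mul_nrm : ∃ K : ℝ, 0 ≤ K ∧ ∀ y : Ω → ℝ, ‖y‖ ≤ K * G.nrm y := by
  -- The unit sphere is empty when `Ω` is.
  rcases (Metric.sphere (0 : Ω → ℝ) 1).eq_empty_or_nonempty with h | h
  · refine ⟨0, le_rfl, fun y => ?_⟩
    by_contra! hy
    have hy0 : ‖y‖ ≠ 0 := by intro h0; simp [h0] at hy
    have : ‖y‖⁻¹ • y ∈ Metric.sphere (0 : Ω → ℝ) 1 := by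
      simp [norm_smul, hy0]
    simp [h] at this
  · obtain ⟨u, hu, hmin⟩ := (isCompact_sphere (0 : Ω → ℝ) 1).exists_isMinOn h
      G.nrm_continuous.continuousOn
    have hupos : 0 < G.nrm u := by
      refine lt_of_le_of_ne (apply_nonneg _ _) fun h0 => ?_
      have := G.nrm_definite u h0.symm
      simp [this] at hu
    refine ⟨(G.nrm u)⁻¹, by positivity, fun y => ?_⟩
    rw [inv_mul_eq_div, le_div_iff₀ hupos]
    by_cases hy : y = 0
    · simp [hy]
    have hy0 : 0 < ‖y‖ := norm_pos_iff.2 hy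
    have hm : G.nrm u ≤ G.nrm (‖y‖⁻¹ • y) := hmin (by simp [norm_smul, hy0.ne'])
    rw [map_smul_eq_mul, norm_inv, norm_norm, inv_mul_eq_div, le_div_iff₀ hy0] at hm
    linarith

theorem isCompact_nrm_ball (c : Ω → ℝ) (t : ℝ) : IsCompact {y | G.nrm (y - c) ≤ t} := by
  obtain ⟨K, hK, h⟩ := G.exists_norm_le_mul_nrm
  refine Metric.isCompact_of_isClosed_isBounded
    (isClosed_le (G.nrm_continuous.comp (continuous_id.sub continuous_const)) continuous_const) ?_
  refine (Metric.isBounded_closedBall (x := c) (r := K * t)).subset fun y hy => ?_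
  rw [mem_closedBall_iff_norm]
  exact (h _).trans (mul_le_mul_of_nonneg_left hy hK)

theorem exists_pairing_le : ∃ K : ℝ, 0 ≤ K ∧ ∀ y z : Ω → ℝ,
    ∑ ω, y ω * z ω ≤ K * G.nrm y * ‖z‖ := by
  obtain ⟨K, hK, h⟩ := G.exists_norm_le_mul_nrm
  refine ⟨Fintype.card Ω * K, by positivity, fun y z => ?_⟩
  calc ∑ ω, y ω * z ω ≤ ∑ _ω : Ω, K * G.nrm y * ‖z‖ := by
        refine Finset.sum_le_sum fun ω _ => ?_
        calc y ω * z ω ≤ ‖y ω‖ * ‖z ω‖ := by rw [← norm_mul]; exact Real.le_norm_self _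
          _ ≤ ‖y‖ * ‖z‖ := by gcongr <;> exact norm_le_pi_norm _ ω
          _ ≤ K * G.nrm y * ‖z‖ := by gcongr; exact h y
    _ = _ := by simp; ring

theorem bddAbove_dualNorm (z : Ω → ℝ) :
    BddAbove {t | ∃ y : Ω → ℝ, G.nrm y ≤ 1 ∧ t = ∑ ω, y ω * z ω} := by
  obtain ⟨K, hK, h⟩ := G.exists_pairing_le
  refine ⟨K * ‖z‖, ?_⟩
  rintro _ ⟨y, hy, rfl⟩
  refine (h y z).trans ?_
  gcongr
  exact mul_le_of_le_one_right hK hy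

theorem dualNorm_nonneg (z : Ω → ℝ) : 0 ≤ G.dualNorm z :=
  le_csSup (G.bddAbove_dualNorm z) ⟨0, by simp, by simp⟩

theorem pairing_le_nrm_mul_dualNorm (y z : Ω → ℝ) :
    ∑ ω, y ω * z ω ≤ G.nrm y * G.dualNorm z := by
  by_cases hy : G.nrm y = 0
  · simp [G.nrm_definite y hy]
  have hpos : 0 < G.nrm y := lt_of_le_of_ne (apply_nonneg _ _) (Ne.symm hy)
  have h : ∑ ω, ((G.nrm y)⁻¹ • y) ω * z ω ≤ G.dualNorm z := by
    refine le_csSup (G.bddAbove_dualNorm z) ⟨_, ?_, rfl⟩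
    rw [map_smul_eq_mul, norm_inv, Real.norm_of_nonneg hpos.le, inv_mul_cancel₀ hy]
  simp only [Pi.smul_apply, smul_eq_mul, mul_assoc] at h
  rw [← Finset.mul_sum, inv_mul_eq_div, div_le_iff₀ hpos] at h
  linarith

theorem exists_pairing_eq_dualNorm (z : Ω → ℝ) :
    ∃ y, G.nrm y ≤ 1 ∧ ∑ ω, y ω * z ω = G.dualNorm z := by
  have hc : IsCompact {y | G.nrm y ≤ 1} := by simpa using G.isCompact_nrm_ball 0 1
  obtain ⟨y, hy, hmax⟩ := hc.exists_isMaxOn ⟨0, by simp⟩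
    (f := fun y : Ω → ℝ => ∑ ω, y ω * z ω) (by fun_prop)
  refine ⟨y, hy, le_antisymm (le_csSup (G.bddAbove_dualNorm z) ⟨y, hy, rfl⟩) ?_⟩
  refine csSup_le ⟨_, 0, by simp, rfl⟩ ?_
  rintro _ ⟨w, hw, rfl⟩
  exact hmax hw

theorem dualNorm_le_kappa_mul (z : Ω → ℝ) : G.dualNorm z ≤ G.kappa * ‖z‖ := by
  by_cases hz : z = 0
  · obtain ⟨y, -, h⟩ := G.exists_pairing_eq_dualNorm z
    rw [← h]
    simp [hz]
  have hpos : 0 < ‖z‖ := norm_pos_iff.2 hz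
  rw [← div_le_iff₀ hpos]
  obtain ⟨K, hK, h⟩ := G.exists_pairing_le
  refine le_ciSup (f := fun z : {z : Ω → ℝ // z ≠ 0} => G.dualNorm z.1 / ‖z.1‖) ?_ ⟨z, hz⟩
  refine ⟨K, ?_⟩
  rintro _ ⟨⟨w, hw⟩, rfl⟩
  simp only
  rw [div_le_iff₀ (norm_pos_iff.2 hw)]
  refine csSup_le ⟨_, 0, by simp, rfl⟩ ?_
  rintro _ ⟨y, hy, rfl⟩
  refine (h y w).trans ?_
  gcongr
  exact mul_le_of_le_one_right hK hy

theorem kappa_nonneg : 0 ≤ G.kappa :=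
  Real.iSup_nonneg fun _ => div_nonneg (G.dualNorm_nonneg _) (norm_nonneg _)

theorem deltaMax_nonneg : 0 ≤ G.deltaMax := Real.iSup_nonneg fun _ => abs_nonneg _

theorem abs_gap_le_deltaMax (i : DevPair E) (ω : Ω) (x : G.X) : |G.gap i ω x| ≤ G.deltaMax :=
  le_ciSup (f := fun q : DevPair E × Ω × G.X => |G.gap q.1 q.2.1 q.2.2|)
    (Set.finite_range _).bddAbove (i, ω, x)

/-- Under a policy the deviation vector is an average of realized gaps. -/
theorem dualNorm_devVec_le {π : G.PolicySpace} (hπ : π ∈ G.policies) (i : DevPair E) :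
    G.dualNorm (G.devVec i π) ≤ G.kappa * G.deltaMax := by
  refine (G.dualNorm_le_kappa_mul _).trans (mul_le_mul_of_nonneg_left ?_ G.kappa_nonneg)
  refine (pi_norm_le_iff_of_nonneg G.deltaMax_nonneg).2 fun ω => ?_
  calc ‖∑ x, π (ω, x) * G.gap i ω x‖ ≤ ∑ x, π (ω, x) * G.deltaMax := by
        refine norm_sum_le_of_le _ fun x _ => ?_
        rw [norm_mul, Real.norm_of_nonneg (hπ.1 ω x)]
        exact mul_le_mul_of_nonneg_left (G.abs_gap_le_deltaMax i ω x) (hπ.1 ω x)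
    _ = G.deltaMax := by rw [← Finset.sum_mul, hπ.2, one_mul]

/-! ### Linearity of cost and slack, and the tangency of robust slacks -/

/-- The cost as a linear functional of the policy. -/
def costLin : G.PolicySpace →ₗ[ℝ] ℝ where
  toFun := G.cost
  map_add' π π' := by
    simp only [cost, PiLp.add_apply, add_mul, Finset.sum_add_distrib, mul_add]
  map_smul' c π := by
    simp only [cost, PiLp.smul_apply, smul_eq_mul, mul_assoc, ← Finset.mul_sum, RingHom.id_apply]
    rw [Finset.mul_sum]
    exact Finset.sum_congr rfl fun ω _ => by ring

/-- The obedience slack under a fixed belief as a linear functional of the policy. -/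
def slackLin (i : DevPair E) (μ : Ω → ℝ) : G.PolicySpace →ₗ[ℝ] ℝ where
  toFun π := G.slack i π μ
  map_add' π π' := by
    simp only [slack, PiLp.add_apply, add_mul, Finset.sum_add_distrib, mul_add]
  map_smul' c π := by
    simp only [slack, PiLp.smul_apply, smul_eq_mul, mul_assoc, ← Finset.mul_sum,
      RingHom.id_apply]
    rw [Finset.mul_sum]
    exact Finset.sum_congr rfl fun ω _ => by ring

@[simp] theorem costLin_apply (π : G.PolicySpace) : G.costLin π = G.cost π := rfl

@[simp] theorem slackLin_apply (i : DevPair E) (μ : Ω → ℝ) (π : G.PolicySpace) :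
    G.slackLin i μ π = G.slack i π μ := rfl

theorem hasFDerivAt_cost (π : G.PolicySpace) :
    HasFDerivAt G.cost (LinearMap.toContinuousLinearMap G.costLin) π :=
  (LinearMap.toContinuousLinearMap G.costLin).hasFDerivAt

theorem hasFDerivAt_slack (i : DevPair E) (μ : Ω → ℝ) (π : G.PolicySpace) :
    HasFDerivAt (fun π' => G.slack i π' μ) (LinearMap.toContinuousLinearMap (G.slackLin i μ)) π :=
  (LinearMap.toContinuousLinearMap (G.slackLin i μ)).hasFDerivAt

theorem slack_eq_add_pairing (i : DevPair E) (π : G.PolicySpace) (μ ν : Ω → ℝ) :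
    G.slack i π μ = G.slack i π ν + ∑ ω, (μ - ν) ω * G.devVec i π ω := by
  simp only [slack, devVec, ← Finset.sum_add_distrib, Pi.sub_apply]
  exact Finset.sum_congr rfl fun ω _ => by ring

theorem robustSlack_le_slack (i : DevPair E) (π : G.PolicySpace) {μ : Ω → ℝ} {ε : ℝ}
    (hμ : G.nrm (μ - G.prior) ≤ ε) : G.robustSlack i π ε ≤ G.slack i π μ := by
  rw [robustSlack, G.slack_eq_add_pairing i π G.prior μ]
  have h := G.pairing_le_nrm_mul_dualNorm (G.prior - μ) (G.devVec i π)
  rw [map_sub_rev] at h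
  have := mul_le_mul_of_nonneg_right hμ (G.dualNorm_nonneg (G.devVec i π))
  linarith

/-- If `h_i(·, ε)` touches the linear function `A_i(·; μ)` at `π` for a belief `μ` in the
uncertainty ball, it is tangent to it there, because it lies below it everywhere. -/
theorem fderiv_robustSlack_eq_slack {i : DevPair E} {π : G.PolicySpace} {μ : Ω → ℝ} {ε : ℝ}
    (hd : DifferentiableAt ℝ (fun π' => G.robustSlack i π' ε) π)
    (hμ : G.nrm (μ - G.prior) ≤ ε) (heq : G.robustSlack i π ε = G.slack i π μ)
    (v : G.PolicySpace) :
    fderiv ℝ (fun π' => G.robustSlack i π' ε) π v = G.slack i v μ := by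
  have hmin : IsLocalMin (fun π' => G.slack i π' μ - G.robustSlack i π' ε) π := by
    refine Filter.Eventually.of_forall fun π' => ?_
    have := G.robustSlack_le_slack i π' hμ
    simp only [heq, sub_self]
    linarith
  have h := hmin.hasFDerivAt_eq_zero ((G.hasFDerivAt_slack i μ π).sub hd.hasFDerivAt)
  have h' := congrArg (fun L => L v) h
  simp at h'
  linarith

/-- The worst case in `h_i(π, ε)` is attained at some `μ` in the ball of radius `ε` around the
prior; this `μ` need not be a probability vector. -/
theorem exists_slack_eq_robustSlack (i : DevPair E) (π : G.PolicySpace) {ε : ℝ} (hε : 0 ≤ ε) :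
    ∃ μ, G.nrm (μ - G.prior) ≤ ε ∧ G.slack i π μ = G.robustSlack i π ε := by
  obtain ⟨y, hy, h⟩ := G.exists_pairing_eq_dualNorm (G.devVec i π)
  refine ⟨G.prior - ε • y, ?_, ?_⟩
  · rw [sub_sub_cancel_left, map_neg_eq_map, map_smul_eq_mul, Real.norm_of_nonneg hε]
    exact mul_le_of_le_one_right hε hy
  · rw [G.slack_eq_add_pairing i π _ G.prior, robustSlack, ← h, Finset.mul_sum,
      sub_eq_add_neg (G.slack i π G.prior), ← Finset.sum_neg_distrib]
    congr 1
    refine Finset.sum_congr rfl fun ω _ => ?_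
    simp only [Pi.sub_apply, Pi.smul_apply, smul_eq_mul]
    ring

/-! ### Feasible regions and the value function -/

theorem dualRegion_subset_robustRegion (ε : ℝ) : G.dualRegion ε ⊆ G.robustRegion ε :=
  fun π hπ => ⟨hπ.1, fun _ hμ i => (hπ.2 i).trans (G.robustSlack_le_slack i π hμ.2)⟩

theorem dualRegion_antitone : Antitone G.dualRegion := fun s t hst π hπ =>
  ⟨hπ.1, fun i => (hπ.2 i).trans (by
    unfold robustSlack
    gcongr
    exact G.dualNorm_nonneg _)⟩

theorem robustRegion_antitone : Antitone G.robustRegion := fun _ _ hst _ hπ =>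
  ⟨hπ.1, fun μ hμ i => hπ.2 μ ⟨hμ.1, hμ.2.trans hst⟩ i⟩

theorem add_smul_mem_policies {π v : G.PolicySpace} (hπ : π ∈ G.policies) (hv : v ∈ G.tangent)
    {t : ℝ} (h : ∀ p, 0 ≤ (π + t • v) p) : π + t • v ∈ G.policies := by
  refine ⟨fun ω x => h _, fun ω => ?_⟩
  have hv' : ∑ x, v (ω, x) = 0 := hv ω
  simp only [PiLp.add_apply, PiLp.smul_apply, smul_eq_mul, Finset.sum_add_distrib, hπ.2 ω,
    ← Finset.mul_sum, hv', mul_zero, add_zero]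

theorem sub_mem_tangent {π π' : G.PolicySpace} (hπ : π ∈ G.policies) (hπ' : π' ∈ G.policies) :
    π' - π ∈ G.tangent := by
  intro ω
  simp only [PiLp.sub_apply, Finset.sum_sub_distrib, hπ.2 ω, hπ'.2 ω, sub_self]

theorem eventually_add_smul_mem_policies {π v : G.PolicySpace} (hπ : π ∈ G.policies)
    (hpos : ∀ p, 0 < π p) (hv : v ∈ G.tangent) :
    ∀ᶠ t : ℝ in 𝓝 0, π + t • v ∈ G.policies := by
  have h : ∀ᶠ t : ℝ in 𝓝 0, ∀ p, 0 < (π + t • v) p := by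
    refine Filter.eventually_all.2 fun p => ?_
    have hc : ContinuousAt (fun t : ℝ => (π + t • v) p) 0 := by
      simp only [PiLp.add_apply, PiLp.smul_apply]
      fun_prop
    exact hc.eventually (lt_mem_nhds (by simpa using hpos p))
  exact h.mono fun t ht => G.add_smul_mem_policies hπ hv fun p => (ht p).le

theorem bddBelow_cost_image {S : Set G.PolicySpace} (hS : S ⊆ G.policies) :
    BddBelow (G.cost '' S) := by
  refine ⟨0, ?_⟩
  rintro _ ⟨π, hπ, rfl⟩
  refine Finset.sum_nonneg fun ω _ => mul_nonneg (G.prior_mem.1 ω) (Finset.sum_nonneg fun x _ =>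
    mul_nonneg ((hS hπ).1 ω x) (Finset.sum_nonneg fun e _ => ?_))
  have hx := (G.X_subset x.1 x.2).1 e
  exact mul_nonneg hx (add_nonneg (mul_nonneg (G.slope_pos ω e).le hx) (G.freeFlow_nonneg ω e))

theorem value_eq_cost {R : ℝ → Set G.PolicySpace} {ε : ℝ} {π : G.PolicySpace}
    (h : G.IsOptimal (R ε) π) : G.value R ε = G.cost π := by
  refine IsLeast.csInf_eq ⟨mem_image_of_mem _ h.1, ?_⟩
  rintro _ ⟨π', hπ', rfl⟩
  exact h.2 hπ'

variable {G}

/-- If the slack of `i` at `π` is positive under every belief in `U_ε(μ₀)`, then it remains so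
near `π`, by compactness of `U_ε(μ₀)`. -/
theorem eventually_slack_pos {i : DevPair E} {π : G.PolicySpace} {ε : ℝ}
    (h : ∀ μ ∈ G.beliefs ε, 0 < G.slack i π μ) :
    ∀ᶠ π' in 𝓝 π, ∀ μ ∈ G.beliefs ε, 0 < G.slack i π' μ := by
  have hK : IsCompact (G.beliefs ε) :=
    (G.isCompact_nrm_ball G.prior ε).inter_left (isClosed_stdSimplex ℝ Ω)
  have hc : Continuous fun p : G.PolicySpace × (Ω → ℝ) => G.slack i p.1 p.2 := by
    unfold slack
    fun_prop
  exact hK.eventually_forall_of_forall_eventually fun μ hμ =>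
    hc.continuousAt.eventually (lt_mem_nhds (h μ hμ))

theorem slack_add_smul (i : DevPair E) (π v : G.PolicySpace) (t : ℝ) (μ : Ω → ℝ) :
    G.slack i (π + t • v) μ = G.slack i π μ + t * G.slack i v μ := by
  simp only [← slackLin_apply, map_add, map_smul, smul_eq_mul]

theorem cost_add_smul (π v : G.PolicySpace) (t : ℝ) :
    G.cost (π + t • v) = G.cost π + t * G.cost v := by
  simp only [← costLin_apply, map_add, map_smul, smul_eq_mul]

/-! ### Stationarity, multipliers and the constraint qualification -/

theorem inner_projGrad {i : DevPair E} {π v : G.PolicySpace} {ε : ℝ} (hv : v ∈ G.tangent) :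
    inner ℝ (G.projGrad i π ε) v = fderiv ℝ (fun π' => G.robustSlack i π' ε) π v := by
  rw [projGrad, Submodule.inner_starProjection_left_eq_right,
    Submodule.starProjection_eq_self_iff.2 hv, inner_gradient_left]

theorem inner_projCostGrad {π v : G.PolicySpace} (hv : v ∈ G.tangent) :
    inner ℝ (G.projCostGrad π) v = G.cost v := by
  rw [projCostGrad, Submodule.inner_starProjection_left_eq_right,
    Submodule.starProjection_eq_self_iff.2 hv, inner_gradient_left, (G.hasFDerivAt_cost π).fderiv]
  rfl

variable [DecidableEq E]

theorem mem_active {π : G.PolicySpace} {ε : ℝ} {i : DevPair E} :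
    i ∈ G.active π ε ↔ G.robustSlack i π ε = 0 := by
  simp [active]

theorem IsSmoothAt.differentiableAt {ε : ℝ} {π : G.PolicySpace} (h : G.IsSmoothAt ε π)
    {i : DevPair E} (hi : i ∈ G.active π ε) :
    DifferentiableAt ℝ (fun π' => G.robustSlack i π' ε) π := by
  have h1 : DifferentiableAt ℝ (fun p : G.PolicySpace × ℝ => G.robustSlack i p.1 p.2) (π, ε) :=
    (h.2 i hi).differentiableAt (by norm_num)
  exact h1.comp (f := fun π' : G.PolicySpace => (π', ε)) π (by fun_prop)

theorem IsKKTPair.lam_eq_zero {ε : ℝ} {π : G.PolicySpace} {lam : DevPair E → ℝ}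
    (h : G.IsKKTPair ε π lam) {i : DevPair E} (hi : i ∉ G.active π ε) : lam i = 0 :=
  (mul_eq_zero.1 (h.compl i)).resolve_right fun h0 => hi (mem_active.2 h0)

/-- Stationarity in multiplier form. -/
theorem IsKKTPair.projCostGrad_eq {ε : ℝ} {π : G.PolicySpace} {lam : DevPair E → ℝ}
    (h : G.IsKKTPair ε π lam) (hs : G.IsSmoothAt ε π) :
    G.projCostGrad π = ∑ i ∈ G.active π ε, lam i • G.projGrad i π ε := by
  have hL : HasFDerivAt (G.lagrangian lam ε) (fderiv ℝ G.cost π -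
      ∑ i, lam i • fderiv ℝ (fun π' => G.robustSlack i π' ε) π) π := by
    refine (G.hasFDerivAt_cost π).differentiableAt.hasFDerivAt.sub
      (HasFDerivAt.fun_sum fun i _ => ?_)
    by_cases hi : i ∈ G.active π ε
    · exact (hs.differentiableAt hi).hasFDerivAt.const_mul _
    · simpa [h.lam_eq_zero hi] using hasFDerivAt_const (0 : ℝ) π
  have hg := h.stationary
  rw [gradient, hL.fderiv] at hg
  simp only [map_sub, map_sum, map_smulₛₗ, sub_eq_zero, conj_trivial] at hg
  rw [projCostGrad, gradient, hg]
  refine (Finset.sum_subset (Finset.subset_univ _) fun i _ hi => ?_).symm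
  simp [h.lam_eq_zero hi]

/-- Along tangent directions the cost is the multiplier combination of the derivatives of the
active constraints. -/
theorem IsKKTPair.cost_eq {ε : ℝ} {π : G.PolicySpace} {lam : DevPair E → ℝ}
    (h : G.IsKKTPair ε π lam) (hs : G.IsSmoothAt ε π) {v : G.PolicySpace} (hv : v ∈ G.tangent) :
    G.cost v = ∑ i ∈ G.active π ε, lam i * fderiv ℝ (fun π' => G.robustSlack i π' ε) π v := by
  rw [← inner_projCostGrad (π := π) hv, h.projCostGrad_eq hs, sum_inner]
  refine Finset.sum_congr rfl fun i _ => ?_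
  rw [real_inner_smul_left, inner_projGrad hv]

theorem toEuclideanLin_jacobian_apply (π : G.PolicySpace) (ε : ℝ)
    (w : EuclideanSpace ℝ (G.active π ε)) :
    Matrix.toEuclideanLin (G.jacobian π ε) w = ∑ i, w i • G.projGrad i.1 π ε := by
  ext p
  simp [Matrix.toLpLin_apply, Matrix.mulVec, dotProduct, jacobian, mul_comm]

theorem sigmaMin_mul_norm_le (π : G.PolicySpace) (ε : ℝ) (w : EuclideanSpace ℝ (G.active π ε)) :
    G.sigmaMin π ε * ‖w‖ ≤ ‖Matrix.toEuclideanLin (G.jacobian π ε) w‖ :=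
  LinearMap.singularValues_mul_norm_le _ (by simp) w

/-- The multipliers are controlled by the projected cost gradient: Cauchy–Schwarz passes from the
`ℓ¹` to the `ℓ²` norm, and the smallest singular value bounds the latter. -/
theorem IsKKTPair.sum_lam_le {ε : ℝ} {π : G.PolicySpace} {lam : DevPair E → ℝ}
    (h : G.IsKKTPair ε π lam) (hs : G.IsSmoothAt ε π)
    (hLICQ : (G.active π ε).Nonempty → 0 < G.sigmaMin π ε) :
    ∑ i ∈ G.active π ε, lam i
      ≤ √((G.active π ε).card : ℝ) * (‖G.projCostGrad π‖ / G.sigmaMin π ε) := by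
  rcases (G.active π ε).eq_empty_or_nonempty with h0 | h0
  · simp [h0]
  set w : EuclideanSpace ℝ (G.active π ε) := WithLp.toLp 2 fun i => lam i.1 with hw
  have h1 : Matrix.toEuclideanLin (G.jacobian π ε) w = G.projCostGrad π := by
    rw [toEuclideanLin_jacobian_apply, h.projCostGrad_eq hs]
    exact Finset.sum_coe_sort (G.active π ε) fun i => lam i • G.projGrad i π ε
  have h2 : ‖w‖ ≤ ‖G.projCostGrad π‖ / G.sigmaMin π ε := by
    rw [le_div_iff₀ (hLICQ h0), mul_comm, ← h1]
    exact sigmaMin_mul_norm_le π ε w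
  refine le_trans ?_ (mul_le_mul_of_nonneg_left h2 (Real.sqrt_nonneg _))
  have h3 : ‖w‖ = √(∑ i ∈ G.active π ε, lam i ^ 2) := by
    rw [EuclideanSpace.norm_eq, ← Finset.sum_coe_sort (G.active π ε) fun i => lam i ^ 2]
    simp [hw]
  rw [h3, ← Real.sqrt_mul (Nat.cast_nonneg _)]
  exact Real.le_sqrt_of_sq_le sq_sum_le_card_mul_sum_sq

/-- Independence of the active gradients lets their derivatives be prescribed along `T`. -/
theorem exists_tangent_fderiv_eq {ε : ℝ} {π : G.PolicySpace}
    (hLICQ : (G.active π ε).Nonempty → 0 < G.sigmaMin π ε) (c : DevPair E → ℝ) :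
    ∃ v ∈ G.tangent, ∀ i ∈ G.active π ε,
      fderiv ℝ (fun π' => G.robustSlack i π' ε) π v = c i := by
  rcases (G.active π ε).eq_empty_or_nonempty with h0 | h0
  · exact ⟨0, zero_mem _, by simp [h0]⟩
  set J := Matrix.toEuclideanLin (G.jacobian π ε) with hJ
  have hinj : Function.Injective J := by
    rw [injective_iff_map_eq_zero]
    intro w hw
    have h1 := sigmaMin_mul_norm_le π ε w
    rw [← hJ, hw, norm_zero] at h1
    exact norm_le_zero_iff.1 (nonpos_of_mul_nonpos_right h1 (hLICQ h0))
  -- The Gram operator `J† J` is injective, hence surjective.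
  have hsurj : Function.Surjective (J.adjoint ∘ₗ J) := by
    rw [← LinearMap.injective_iff_surjective]
    exact (LinearMap.adjoint_comp_self_injective_iff J).2 hinj
  obtain ⟨w, hw⟩ := hsurj (WithLp.toLp 2 fun i => c i.1)
  have hmem : J w ∈ G.tangent := by
    rw [hJ, toEuclideanLin_jacobian_apply]
    exact sum_mem fun i _ => Submodule.smul_mem _ _ (Submodule.starProjection_apply_mem _ _)
  refine ⟨J w, hmem, fun i hi => ?_⟩
  rw [← inner_projGrad hmem]
  have h1 : J (EuclideanSpace.single ⟨i, hi⟩ 1) = G.projGrad i π ε := by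
    rw [hJ, toEuclideanLin_jacobian_apply, Finset.sum_eq_single ⟨i, hi⟩]
    · simp
    · intro b _ hb
      simp [hb]
    · simp
  rw [← h1, ← LinearMap.adjoint_inner_right, ← LinearMap.comp_apply, hw,
    EuclideanSpace.inner_single_left]
  simp

/-! ### Sensitivity of the optimal cost -/

theorem kappa_mul_deltaMax_mul_sum_lam_le_slopeBound {ε : ℝ} {π : G.PolicySpace}
    {lam : DevPair E → ℝ}
    (h : G.IsKKTPair ε π lam) (hs : G.IsSmoothAt ε π)
    (hLICQ : (G.active π ε).Nonempty → 0 < G.sigmaMin π ε) :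
    G.kappa * G.deltaMax * ∑ i ∈ G.active π ε, lam i ≤ G.slopeBound ε π := by
  rw [slopeBound, mul_assoc (G.kappa * G.deltaMax)]
  exact mul_le_mul_of_nonneg_left (h.sum_lam_le hs hLICQ)
    (mul_nonneg G.kappa_nonneg G.deltaMax_nonneg)

/-- Sensitivity of the optimal cost to shrinking the uncertainty set. The set `K` of admissible
beliefs is `univ` for `dualRegion` and the simplex for `robustRegion`. A belief `μ` that is binding
for a pair with positive multiplier is moved towards the prior by the factor `s / ε`; obedience of `π'`
under the moved belief then bounds its slack under `μ`, up to the distance moved. -/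
theorem IsKKTPair.cost_sub_le {ε : ℝ} {π : G.PolicySpace} {lam : DevPair E → ℝ}
    (h : G.IsKKTPair ε π lam) (hs : G.IsSmoothAt ε π) (hε : 0 < ε)
    {K : Set (Ω → ℝ)} (hK : Convex ℝ K) (hprior : G.prior ∈ K)
    (hbind : ∀ i ∈ G.active π ε, lam i ≠ 0 →
      ∃ μ ∈ K, G.nrm (μ - G.prior) ≤ ε ∧ G.slack i π μ = 0)
    {s : ℝ} (hs0 : 0 ≤ s) (hsε : s ≤ ε) {π' : G.PolicySpace} (hπ' : π' ∈ G.policies)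
    (hob : ∀ μ ∈ K, G.nrm (μ - G.prior) ≤ s → ∀ i, 0 ≤ G.slack i π' μ) :
    G.cost π - (ε - s) * (G.kappa * G.deltaMax * ∑ i ∈ G.active π ε, lam i) ≤ G.cost π' := by
  have hcost : G.cost π' = G.cost π + G.cost (π' - π) := by
    simp only [← costLin_apply, map_sub]
    ring
  rw [hcost, h.cost_eq hs (G.sub_mem_tangent h.feasible.1 hπ'), Finset.mul_sum, Finset.mul_sum,
    sub_eq_add_neg, ← Finset.sum_neg_distrib]
  refine add_le_add_right (Finset.sum_le_sum fun i hi => ?_) _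
  by_cases hlam : lam i = 0
  · simp [hlam]
  obtain ⟨μ, hμK, hμ, h0⟩ := hbind i hi hlam
  rw [G.fderiv_robustSlack_eq_slack (hs.differentiableAt hi) hμ
    ((mem_active.1 hi).trans h0.symm)]
  have hsub : G.slack i (π' - π) μ = G.slack i π' μ := by
    rw [← slackLin_apply, map_sub, slackLin_apply, slackLin_apply, h0, sub_zero]
  set ν := G.prior + (s / ε) • (μ - G.prior) with hν
  have hνK : ν ∈ K := hK.add_smul_sub_mem hprior hμK
    ⟨div_nonneg hs0 hε.le, div_le_one_of_le₀ hsε hε.le⟩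
  have hνs : G.nrm (ν - G.prior) ≤ s := by
    rw [hν, add_sub_cancel_left, map_smul_eq_mul, Real.norm_of_nonneg (div_nonneg hs0 hε.le)]
    calc s / ε * G.nrm (μ - G.prior) ≤ s / ε * ε := by gcongr
      _ = s := div_mul_cancel₀ s hε.ne'
  have hdist : G.nrm (ν - μ) ≤ ε - s := by
    have hr : 0 ≤ 1 - s / ε := sub_nonneg.2 (div_le_one_of_le₀ hsε hε.le)
    have : ν - μ = -((1 - s / ε) • (μ - G.prior)) := by
      rw [hν]
      module
    rw [this, map_neg_eq_map, map_smul_eq_mul, Real.norm_of_nonneg hr]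
    calc (1 - s / ε) * G.nrm (μ - G.prior) ≤ (1 - s / ε) * ε := by gcongr
      _ = ε - s := by field_simp
  have h1 := G.slack_eq_add_pairing i π' ν μ
  have h2 := G.pairing_le_nrm_mul_dualNorm (ν - μ) (G.devVec i π')
  have h3 : G.nrm (ν - μ) * G.dualNorm (G.devVec i π') ≤ (ε - s) * (G.kappa * G.deltaMax) :=
    mul_le_mul hdist (G.dualNorm_devVec_le hπ' i) (G.dualNorm_nonneg _) (sub_nonneg.2 hsε)
  have h4 : -((ε - s) * (G.kappa * G.deltaMax)) ≤ G.slack i (π' - π) μ := by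
    have := hob ν hνK hνs i
    linarith
  have := mul_le_mul_of_nonneg_left h4 (h.nonneg i)
  linarith

/-- At an optimal policy of `robustRegion` with positive entries, a positive multiplier belongs to
a pair that some *probability vector* in the uncertainty set makes binding. Otherwise
`robustRegion` would leave room to decrease `h_j` for that pair `j` while slightly increasing the
other active `h_i`, and the cost would drop. -/
theorem IsKKTPair.exists_binding_belief {ε : ℝ} {π : G.PolicySpace} {lam : DevPair E → ℝ}
    (h : G.IsKKTPair ε π lam) (hs : G.IsSmoothAt ε π)
    (hLICQ : (G.active π ε).Nonempty → 0 < G.sigmaMin π ε)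
    (hopt : G.IsOptimal (G.robustRegion ε) π) (hpos : ∀ p, 0 < π p)
    {j : DevPair E} (hj : j ∈ G.active π ε) (hlam : lam j ≠ 0) :
    ∃ μ ∈ stdSimplex ℝ Ω, G.nrm (μ - G.prior) ≤ ε ∧ G.slack j π μ = 0 := by
  by_contra! hcon
  have hjpos : ∀ μ ∈ G.beliefs ε, 0 < G.slack j π μ := fun μ hμ =>
    lt_of_le_of_ne (hopt.1.2 μ hμ j) (Ne.symm (hcon μ hμ.1 hμ.2))
  have hlampos : 0 < lam j := lt_of_le_of_ne (h.nonneg j) (Ne.symm hlam)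
  set Λ := ∑ i ∈ (G.active π ε).erase j, lam i with hΛ
  have hΛ0 : 0 ≤ Λ := Finset.sum_nonneg fun i _ => h.nonneg i
  -- The rate `δ` is small enough for the gain `lam j` to exceed the loss `δ * Λ`.
  set δ := lam j / (Λ + 1) with hδ
  have hδpos : 0 < δ := by positivity
  obtain ⟨v, hv, hvd⟩ := exists_tangent_fderiv_eq hLICQ (fun i => if i = j then -1 else δ)
  have hcostv : G.cost v < 0 := by
    rw [h.cost_eq hs hv, ← Finset.add_sum_erase _ _ hj, hvd j hj, if_pos rfl,
      Finset.sum_congr rfl (g := fun i => lam i * δ) fun i hi => by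
        rw [hvd i (Finset.mem_of_mem_erase hi), if_neg (Finset.ne_of_mem_erase hi)],
      ← Finset.sum_mul, ← hΛ, hδ]
    have : Λ * (lam j / (Λ + 1)) < lam j := by
      rw [mul_div_assoc', div_lt_iff₀ (by positivity)]
      nlinarith
    linarith
  have hline : Filter.Tendsto (fun t : ℝ => π + t • v) (𝓝[>] 0) (𝓝 π) := by
    have : Continuous fun t : ℝ => π + t • v := by fun_prop
    simpa using (this.tendsto 0).mono_left nhdsWithin_le_nhds
  have hob : ∀ᶠ t : ℝ in 𝓝[>] 0, ∀ i, ∀ μ ∈ G.beliefs ε, 0 ≤ G.slack i (π + t • v) μ := by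
    refine Filter.eventually_all.2 fun i => ?_
    by_cases hi : (∀ μ ∈ G.beliefs ε, 0 < G.slack i π μ)
    · exact (hline.eventually (eventually_slack_pos hi)).mono fun t ht μ hμ => (ht μ hμ).le
    have hia : i ∈ G.active π ε := by
      by_contra hia
      refine hi fun μ hμ => lt_of_lt_of_le ?_ (G.robustSlack_le_slack i π hμ.2)
      exact lt_of_le_of_ne (h.feasible.2 i) fun h0 => hia (mem_active.2 h0.symm)
    have hij : i ≠ j := fun hij => hi (hij ▸ hjpos)
    have hder : HasDerivAt (fun t : ℝ => G.robustSlack i (π + t • v) ε) δ 0 := by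
      have h1 : HasDerivAt (fun t : ℝ => π + t • v) v 0 := by
        simpa using ((hasDerivAt_id (0 : ℝ)).smul_const v).const_add π
      have h2 : HasFDerivAt (fun π' => G.robustSlack i π' ε)
          (fderiv ℝ (fun π' => G.robustSlack i π' ε) π) (π + (0 : ℝ) • v) := by
        simpa using (hs.differentiableAt hia).hasFDerivAt
      have h3 := h2.comp_hasDerivAt (0 : ℝ) h1
      rwa [hvd i hia, if_neg hij] at h3
    have hslope := (hasDerivAt_iff_tendsto_slope.1 hder).mono_left
      (nhdsWithin_mono 0 (fun t (ht : 0 < t) => ht.ne' : Ioi (0 : ℝ) ⊆ {0}ᶜ))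
    filter_upwards [hslope.eventually (lt_mem_nhds hδpos), self_mem_nhdsWithin] with t ht ht0 μ hμ
    refine le_trans ?_ (G.robustSlack_le_slack i _ hμ.2)
    rw [slope_def_field, zero_smul, add_zero, mem_active.1 hia, sub_zero, sub_zero] at ht
    exact ((div_pos_iff_of_pos_right ht0).1 ht).le
  obtain ⟨t, ⟨hpol, hobt⟩, ht0⟩ := ((((G.eventually_add_smul_mem_policies h.feasible.1 hpos
    hv).filter_mono nhdsWithin_le_nhds).and hob).and self_mem_nhdsWithin).exists
  have hle : G.cost π ≤ G.cost (π + t • v) := hopt.2 ⟨hpol, fun μ hμ i => hobt i μ hμ⟩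
  rw [cost_add_smul] at hle
  have := mul_neg_of_pos_of_neg ht0 hcostv
  linarith

/-- Sensitivity of the optimal cost to introducing a small uncertainty set around the prior. All
active slacks are raised along one tangent direction at the rate `κ Δ_max`, which pays for the
worst-case loss; by stationarity, the cost of this direction is `κ Δ_max` times the sum of the
multipliers. -/
theorem IsKKTPair.eventually_exists_mem_dualRegion {π : G.PolicySpace} {lam : DevPair E → ℝ}
    (h : G.IsKKTPair 0 π lam) (hs : G.IsSmoothAt 0 π)
    (hLICQ : (G.active π 0).Nonempty → 0 < G.sigmaMin π 0) (hpos : ∀ p, 0 < π p) :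
    ∀ᶠ t : ℝ in 𝓝[>] 0, ∃ π' ∈ G.dualRegion t,
      G.cost π' = G.cost π + t * (G.kappa * G.deltaMax * ∑ i ∈ G.active π 0, lam i) := by
  obtain ⟨v, hv, hvd⟩ := exists_tangent_fderiv_eq hLICQ fun _ => G.kappa * G.deltaMax
  have hslack0 : ∀ i, G.slack i π G.prior = G.robustSlack i π 0 := fun i => by simp [robustSlack]
  have hcostv : G.cost v = G.kappa * G.deltaMax * ∑ i ∈ G.active π 0, lam i := by
    rw [h.cost_eq hs hv, Finset.mul_sum]
    refine Finset.sum_congr rfl fun i hi => ?_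
    rw [hvd i hi, mul_comm]
  have hinact : ∀ᶠ t : ℝ in 𝓝 0, ∀ i, i ∉ G.active π 0 →
      0 ≤ G.slack i π G.prior + t * G.slack i v G.prior - t * (G.kappa * G.deltaMax) := by
    refine Filter.eventually_all.2 fun i => ?_
    by_cases hi : i ∈ G.active π 0
    · simp [hi]
    have h0 : 0 < G.slack i π G.prior := by
      rw [hslack0]
      exact lt_of_le_of_ne (h.feasible.2 i) fun h0 => hi (mem_active.2 h0.symm)
    have hc : Continuous fun t : ℝ =>
        G.slack i π G.prior + t * G.slack i v G.prior - t * (G.kappa * G.deltaMax) := by fun_prop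
    exact (hc.continuousAt.eventually (lt_mem_nhds (by simpa using h0))).mono fun t ht _ => ht.le
  filter_upwards [nhdsWithin_le_nhds hinact, self_mem_nhdsWithin, nhdsWithin_le_nhds
    (G.eventually_add_smul_mem_policies h.feasible.1 hpos hv)] with t ht ht0 hpol
  refine ⟨π + t • v, ⟨hpol, fun i => ?_⟩, by rw [cost_add_smul, hcostv]⟩
  have hdual := mul_le_mul_of_nonneg_left (G.dualNorm_devVec_le hpol i) (le_of_lt ht0)
  rw [robustSlack, slack_add_smul]
  by_cases hi : i ∈ G.active π 0
  · have h1 : G.slack i v G.prior = G.kappa * G.deltaMax := by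
      rw [← hvd i hi, G.fderiv_robustSlack_eq_slack (hs.differentiableAt hi) (by simp)
        (hslack0 i).symm]
    rw [hslack0, mem_active.1 hi, h1]
    linarith
  · linarith [ht i hi]

/-! ### Bounds for the derivative of the value function -/

/-- The slope bound at a positive radius, from the left difference quotients. -/
theorem IsKKTPair.derivWithin_value_le {ε : ℝ} {π : G.PolicySpace} {lam : DevPair E → ℝ}
    (h : G.IsKKTPair ε π lam) (hs : G.IsSmoothAt ε π)
    (hLICQ : (G.active π ε).Nonempty → 0 < G.sigmaMin π ε) (hε : 0 < ε)
    {R : ℝ → Set G.PolicySpace} (hR : Antitone R) (hopt : G.IsOptimal (R ε) π)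
    {K : Set (Ω → ℝ)} (hK : Convex ℝ K) (hprior : G.prior ∈ K)
    (hbind : ∀ i ∈ G.active π ε, lam i ≠ 0 →
      ∃ μ ∈ K, G.nrm (μ - G.prior) ≤ ε ∧ G.slack i π μ = 0)
    (hRK : ∀ s, ∀ π' ∈ R s, π' ∈ G.policies ∧
      ∀ μ ∈ K, G.nrm (μ - G.prior) ≤ s → ∀ i, 0 ≤ G.slack i π' μ)
    (hd : DifferentiableWithinAt ℝ (G.value R) (feasibleRadii R) ε) :
    derivWithin (G.value R) (feasibleRadii R) ε ≤ G.slopeBound ε π := by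
  have := right_nhdsWithin_Ico_neBot hε
  refine derivWithin_le_of_forall_slope_le hd (T := Ico 0 ε)
    (fun s hsI => ⟨⟨hsI.1, π, hR hsI.2.le hopt.1⟩, hsI.2.ne⟩) fun s hsI => ?_
  refine le_trans ?_ (kappa_mul_deltaMax_mul_sum_lam_le_slopeBound h hs hLICQ)
  have hval : G.cost π - (ε - s) * (G.kappa * G.deltaMax * ∑ i ∈ G.active π ε, lam i)
      ≤ G.value R s := by
    refine le_csInf ⟨_, mem_image_of_mem _ (hR hsI.2.le hopt.1)⟩ ?_
    rintro _ ⟨π', hπ', rfl⟩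
    exact h.cost_sub_le hs hε hK hprior hbind hsI.1 hsI.2.le (hRK s π' hπ').1 (hRK s π' hπ').2
  rw [slope_comm, slope_def_field, G.value_eq_cost hopt, div_le_iff₀ (sub_pos.2 hsI.2)]
  linarith

/-- The slope bound at radius zero, from the right difference quotients. -/
theorem IsKKTPair.derivWithin_value_zero_le {π : G.PolicySpace} {lam : DevPair E → ℝ}
    (h : G.IsKKTPair 0 π lam) (hs : G.IsSmoothAt 0 π)
    (hLICQ : (G.active π 0).Nonempty → 0 < G.sigmaMin π 0) (hpos : ∀ p, 0 < π p)
    {R : ℝ → Set G.PolicySpace} (hopt : G.IsOptimal (R 0) π)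
    (hdual : ∀ s, G.dualRegion s ⊆ R s) (hpol : ∀ s, R s ⊆ G.policies)
    (hd : DifferentiableWithinAt ℝ (G.value R) (feasibleRadii R) 0) :
    derivWithin (G.value R) (feasibleRadii R) 0 ≤ G.slopeBound 0 π := by
  obtain ⟨δ, hδ, hsub⟩ := mem_nhdsGT_iff_exists_Ioo_subset.1
    (h.eventually_exists_mem_dualRegion hs hLICQ hpos)
  have := left_nhdsWithin_Ioo_neBot (mem_Ioi.1 hδ)
  refine derivWithin_le_of_forall_slope_le hd (T := Ioo 0 δ) (fun t ht => ?_) fun t ht => ?_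
  · obtain ⟨π', hπ', -⟩ := hsub ht
    exact ⟨⟨ht.1.le, π', hdual t hπ'⟩, ht.1.ne'⟩
  · obtain ⟨π', hπ', hcost⟩ := hsub ht
    refine le_trans ?_ (kappa_mul_deltaMax_mul_sum_lam_le_slopeBound h hs hLICQ)
    have hval : G.value R t ≤ G.cost π' :=
      csInf_le (G.bddBelow_cost_image (hpol t)) (mem_image_of_mem _ (hdual t hπ'))
    rw [slope_def_field, G.value_eq_cost hopt, div_le_iff₀ (sub_pos.2 ht.1)]
    linarith

end SignalingGame

end

theorem mainTheorem3 {E Ω : Type*} [Fintype E] [DecidableEq E] [Fintype Ω]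
    (G : SignalingGame E Ω) (ε : ℝ) (hε : 0 ≤ ε)
    (π : G.PolicySpace) (lam : DevPair E → ℝ)
    (hsmooth : G.IsSmoothAt ε π)
    (hKKT : G.IsKKTPair ε π lam)
    (hLICQ : (G.active π ε).Nonempty → 0 < G.sigmaMin π ε)
    (hSOSC : G.SecondOrderSufficient ε π lam) :
    -- the value function of the problem with constraints `h_{r,a}(π, ε) ≥ 0`
    (G.IsOptimal (G.dualRegion ε) π →
      G.IsIsolatedLocalMin (G.dualRegion ε) π →
      DifferentiableWithinAt ℝ (G.value G.dualRegion)
        (SignalingGame.feasibleRadii G.dualRegion) ε →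
      (ε = 0 → ∀ p, 0 < π p) →
      derivWithin (G.value G.dualRegion) (SignalingGame.feasibleRadii G.dualRegion) ε
        ≤ G.slopeBound ε π) ∧
    -- the value function over the policies obedient under all beliefs in `U_ε(μ₀)`
    (G.IsOptimal (G.robustRegion ε) π →
      G.IsIsolatedLocalMin (G.robustRegion ε) π →
      DifferentiableWithinAt ℝ (G.value G.robustRegion)
        (SignalingGame.feasibleRadii G.robustRegion) ε →
      (∀ p, 0 < π p) →
      derivWithin (G.value G.robustRegion) (SignalingGame.feasibleRadii G.robustRegion) ε
        ≤ G.slopeBound ε π) := by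
  rcases hε.eq_or_lt with rfl | hε
  · exact ⟨fun hopt _ hd hpos => hKKT.derivWithin_value_zero_le hsmooth hLICQ (hpos rfl) hopt
        (fun _ => Subset.rfl) (fun _ _ hp => hp.1) hd,
      fun hopt _ hd hpos => hKKT.derivWithin_value_zero_le hsmooth hLICQ hpos hopt
        G.dualRegion_subset_robustRegion (fun _ _ hp => hp.1) hd⟩
  · refine ⟨fun hopt _ hd _ => hKKT.derivWithin_value_le hsmooth hLICQ hε G.dualRegion_antitone
        hopt convex_univ (mem_univ _) (fun i hi _ => ?_)
        (fun s π' hπ' => ⟨hπ'.1, fun μ _ hμ i =>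
          (hπ'.2 i).trans (G.robustSlack_le_slack i π' hμ)⟩) hd,
      fun hopt _ hd hpos => hKKT.derivWithin_value_le hsmooth hLICQ hε G.robustRegion_antitone
        hopt (convex_stdSimplex ℝ Ω) G.prior_mem
        (fun i hi hlam => hKKT.exists_binding_belief hsmooth hLICQ hopt hpos hi hlam)
        (fun s π' hπ' => ⟨hπ'.1, fun μ hK hμ => hπ'.2 μ ⟨hK, hμ⟩⟩) hd⟩
    obtain ⟨μ, hμ, hμ0⟩ := G.exists_slack_eq_robustSlack i π hε.le
    exact ⟨μ, mem_univ _, hμ, hμ0.trans (SignalingGame.mem_active.1 hi)⟩
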